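/- Let $(X,d)$ be a Hadamard space, i.e. a complete geodesic metric space satisfying $d(x,\gamma(t))^2\le(1-t)\,d(x,\gamma(0))^2+t\,d(x,\gamma(1))^2-t(1-t)\,d(\gamma(0),\gamma(1))^2$ for all $x\in X$, all constant-speed geodesics $\gamma:[0,1]\to X$ and all $t\in[0,1]$. Let $f:X\to(-\infty,\infty]$ and $f^n:X\to(-\infty,\infty]$, $n\in\mathbb N$, be proper lower semicontinuous functions that are convex (along every geodesic). Put $\operatorname{dom} f=\{x\in X: f(x)<\infty\}$. For $\lambda>0$ and $x\in X$ let $$J_\lambda x=\operatorname*{arg\,min}_{y\in X}\Big[f(y)+\tfrac1{2\lambda}d(x,y)^2\Big],$$ and for $t>0$ let $S_t x=\lim_{k\to\infty}(J_{t/k})^{(k)}x$, where $(k)$ denotes the $k$-fold composition; let $J^n_\lambda$ and $S^n_t$ be defined in the same way from $f^n$. Then the minimizers defining $J_\lambda x$ and $J^n_\lambda x$ exist and are unique for all $x\in X$ and $\lambda>0$, the limits defining $S_tx$ and $S^n_tx$ exist for all $x\in\overline{\operatorname{dom} f}$, $t>0$ and $n\in\mathbb N$, and the following hold. 1. If $\lim_{n\to\infty}J^n_\lambda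 x=J_\lambda x$ for every $x\in\overline{\operatorname{dom} f}$ and every $\lambda>0$, then $$\lim_{n\to\infty}S^n_t x=S_t x\qquad\text{for every }x\in\overline{\operatorname{dom} f}\text{ and every }t>0.$$ 2. The same conclusion holds if $f^n\to f$ in the sense of Mosco, i.e. if for every $x\in X$: (M1) $f(x)\le\liminf_{n\to\infty} f^n(x_n)$ for every sequence $(x_n)$ converging weakly to $x$; and (M2) there is a sequence $y_n\to x$ with $f^n(y_n)\to f(x)$. Here a bounded sequence $(x_n)$ converges weakly to $x$ if, for each of its subsequences $(x_{n_k})$, the point $x$ minimizes $y\mapsto\limsup_{k\to\infty}d(y,x_{n_k})^2$ over $X$. -/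

import Mathlib

open Filter Topology

namespace Hadamard

/-- `γ` restricted to `[0,1]` is a (constant speed) geodesic from `γ 0` to `γ 1`;
the values of `γ` outside `[0,1]` play no role. -/
def IsGeodesic {X : Type*} [MetricSpace X] (γ : ℝ → X) : Prop :=
  ∀ s ∈ Set.Icc (0 : ℝ) 1, ∀ t ∈ Set.Icc (0 : ℝ) 1,
    dist (γ s) (γ t) = |s - t| * dist (γ 0) (γ 1)

/-- An Hadamard space: a complete geodesic metric space with the CAT(0) inequality. -/
class HadamardSpace (X : Type*) [MetricSpace X] : Prop where
  complete : CompleteSpace X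
  exists_geodesic : ∀ x y : X, ∃ γ : ℝ → X, IsGeodesic γ ∧ γ 0 = x ∧ γ 1 = y
  cat_zero : ∀ (x : X) (γ : ℝ → X), IsGeodesic γ → ∀ t ∈ Set.Icc (0 : ℝ) 1,
    dist x (γ t) ^ 2 ≤ (1 - t) * dist x (γ 0) ^ 2 + t * dist x (γ 1) ^ 2
      - t * (1 - t) * dist (γ 0) (γ 1) ^ 2

/-- Convexity of a function with values in `(-∞, ∞]`: `f ∘ γ` is convex on `[0,1]` for every
geodesic `γ`. (In `EReal` one has `0 * ⊤ = 0`, so the inequality is trivial at `t = 0` and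
at `t = 1`.) -/
def IsConvex {X : Type*} [MetricSpace X] (f : X → EReal) : Prop :=
  ∀ γ : ℝ → X, IsGeodesic γ →
    ∀ a ∈ Set.Icc (0 : ℝ) 1, ∀ b ∈ Set.Icc (0 : ℝ) 1, ∀ t ∈ Set.Icc (0 : ℝ) 1,
      f (γ ((1 - t) * a + t * b)) ≤ ((1 - t : ℝ) : EReal) * f (γ a) + (t : EReal) * f (γ b)

/-- The effective domain `{x : f x < ∞}`. -/
def dom {X : Type*} (f : X → EReal) : Set X := {x | f x < ⊤}

/-- `f` is a proper convex lower semicontinuous function with values in `(-∞, ∞]`. -/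
structure IsProperConvexLsc {X : Type*} [MetricSpace X] (f : X → EReal) : Prop where
  ne_bot : ∀ x, f x ≠ ⊥
  proper : (dom f).Nonempty
  convex : IsConvex f
  lsc : LowerSemicontinuous f

/-- The function `y ↦ f y + d(x, y)² / (2 r)`. -/
noncomputable def proxFun {X : Type*} [MetricSpace X] (f : X → EReal) (r : ℝ) (x y : X) :
    EReal :=
  f y + ((dist x y ^ 2 / (2 * r) : ℝ) : EReal)

open Classical in
/-- The resolvent `J_r x`: the minimizer of `y ↦ f y + d(x, y)² / (2 r)` for `r > 0`, and
`J_0 x = x`. (The value is also `x` should there be no minimizer.) -/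
noncomputable def resolvent {X : Type*} [MetricSpace X] (f : X → EReal) (r : ℝ) (x : X) : X :=
  if h : 0 < r ∧ ∃ y, IsMinOn (proxFun f r x) Set.univ y then h.2.choose else x

open Classical in
/-- The gradient flow semigroup `S_t x = lim_k (J_{t/k})^(k) x`. (The value is `x` should the
limit not exist.) -/
noncomputable def semigroup {X : Type*} [MetricSpace X] (f : X → EReal) (t : ℝ) (x : X) : X :=
  if h : ∃ y, Tendsto (fun k : ℕ => (resolvent f (t / k))^[k] x) atTop (𝓝 y) then h.choose
  else x

/-- `x` is the asymptotic center of the (bounded) sequence `u`, that is, a minimizer of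
`y ↦ limsup_n d(y, u_n)²`. -/
def IsAsymptoticCenter {X : Type*} [MetricSpace X] (u : ℕ → X) (x : X) : Prop :=
  IsMinOn (fun y => limsup (fun n => dist y (u n) ^ 2) atTop) Set.univ x

/-- Weak convergence of a bounded sequence: `x` is the asymptotic center of each subsequence. -/
def WeaklyTendsto {X : Type*} [MetricSpace X] (u : ℕ → X) (x : X) : Prop :=
  Bornology.IsBounded (Set.range u) ∧
    ∀ φ : ℕ → ℕ, StrictMono φ → IsAsymptoticCenter (u ∘ φ) x

/-- Convergence of the sequence of functions `F n` to `f` in the sense of Mosco. -/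
def MoscoTendsto {X : Type*} [MetricSpace X] (F : ℕ → X → EReal) (f : X → EReal) : Prop :=
  ∀ x : X,
    (∀ u : ℕ → X, WeaklyTendsto u x → f x ≤ liminf (fun n => F n (u n)) atTop) ∧
    ∃ y : ℕ → X, Tendsto y atTop (𝓝 x) ∧ Tendsto (fun n => F n (y n)) atTop (𝓝 (f x))

end Hadamard

/-! Along geodesics `d(x, ·)²` is strongly convex, so `2 r f + d(x, ·)²` exceeds its minimum by at
least the squared distance to the minimizer (`IsProx.add_dist_sq_le`). This growth gives uniqueness
and, with a quadrilateral inequality, nonexpansiveness of `J_r`.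

For part 1, the implicit Euler scheme with `k` steps of size `t/k ≤ r`, started at `J_r x`, is
within `(d(x, J_r x) / r) · t / √k` of the semigroup. This follows from a Crandall–Liggett
comparison of two step sizes (`dist_iterate_iterate_sq_le`). The bound sees the function only
through `d(x, J_r x)`, so convergence of resolvents makes it uniform in large `n`. One fixes `r`
with `J_r x` near `x`, then `k`, and lets `n → ∞` in a finite composition of nonexpansive maps.

Part 2 reduces to part 1, since Mosco convergence implies convergence of resolvents
(`MoscoTendsto.tendsto_resolvent`). The points `J^n_r x` are bounded, so a subsequence has a weak
limit `c`. If it stayed away from `J_r x`, then (M1) at `c`, (M2) at `J_r x` and the growth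
inequality would make `c` strictly better than the minimizer. -/

namespace Hadamard

variable {X : Type*} [MetricSpace X]

/-- The real-valued restriction of `f` to its effective domain. -/
noncomputable def val (f : X → EReal) (x : X) : ℝ := (f x).toReal

theorem IsProperConvexLsc.coe_val {f : X → EReal} (hf : IsProperConvexLsc f) {x : X}
    (hx : x ∈ dom f) : ((val f x : ℝ) : EReal) = f x :=
  EReal.coe_toReal (ne_of_lt hx) (hf.ne_bot x)

theorem IsProperConvexLsc.val_le {f : X → EReal} (hf : IsProperConvexLsc f) {x : X} {c : ℝ}
    (h : f x ≤ c) : x ∈ dom f ∧ val f x ≤ c := by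
  have hx : x ∈ dom f := lt_of_le_of_lt h (EReal.coe_lt_top c)
  refine ⟨hx, ?_⟩
  rw [← hf.coe_val hx] at h
  exact_mod_cast h

theorem le_coe_of_forall_lt {a : EReal} {b : ℝ} (h : ∀ c : ℝ, (c : EReal) < a → c ≤ b) :
    a ≤ b := by
  by_contra! hlt
  obtain ⟨c, h1, h2⟩ := EReal.lt_iff_exists_real_btwn.1 hlt
  exact absurd (h c h2) (not_le.2 (by exact_mod_cast h1))

/-! ### Comparison inequalities in a Hadamard space -/

/-- The point with parameter `t` on a geodesic from `a` to `b`. -/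
theorem exists_point [HadamardSpace X] (a b : X) {t : ℝ} (ht : t ∈ Set.Icc (0 : ℝ) 1) :
    ∃ z : X, dist a z = t * dist a b ∧ dist z b = (1 - t) * dist a b ∧
      (∀ p, dist p z ^ 2 ≤ (1 - t) * dist p a ^ 2 + t * dist p b ^ 2
        - t * (1 - t) * dist a b ^ 2) ∧
      ∀ f : X → EReal, IsProperConvexLsc f → a ∈ dom f → b ∈ dom f →
        z ∈ dom f ∧ val f z ≤ (1 - t) * val f a + t * val f b := by
  obtain ⟨γ, hγ, rfl, rfl⟩ := HadamardSpace.exists_geodesic a b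
  have h0 : (0 : ℝ) ∈ Set.Icc (0 : ℝ) 1 := by simp
  have h1 : (1 : ℝ) ∈ Set.Icc (0 : ℝ) 1 := by simp
  refine ⟨γ t, ?_, ?_, fun p => HadamardSpace.cat_zero p γ hγ t ht, ?_⟩
  · rw [hγ 0 h0 t ht, zero_sub, abs_neg, abs_of_nonneg ht.1]
  · rw [hγ t ht 1 h1, abs_sub_comm, abs_of_nonneg (sub_nonneg.2 ht.2)]
  · intro f hf ha hb
    have h := hf.convex γ hγ 0 h0 1 h1 t ht
    rw [mul_zero, zero_add, mul_one, ← hf.coe_val ha, ← hf.coe_val hb] at h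
    exact hf.val_le (by exact_mod_cast h)

/-- Apply the CAT(0) inequality at the midpoint `m` of `x` and `b`, seen from `y` and from `a`, and
use `d(y, a)² ≤ 2 d(y, m)² + 2 d(a, m)²`. -/
theorem dist_sq_add_dist_sq_le [HadamardSpace X] (x y a b : X) :
    dist x b ^ 2 + dist y a ^ 2 ≤
      dist x a ^ 2 + dist y b ^ 2 + dist x y ^ 2 + dist a b ^ 2 := by
  obtain ⟨m, -, -, hm, -⟩ := exists_point x b (t := 1 / 2) (by norm_num)
  have h1 := hm y
  have h2 := hm a
  have h3 : dist y a ≤ dist y m + dist a m := by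
    simpa [dist_comm m a] using dist_triangle y m a
  have h4 : dist y a ^ 2 ≤ (dist y m + dist a m) ^ 2 := by gcongr
  rw [dist_comm y x] at h1
  rw [dist_comm a x] at h2
  nlinarith [sq_nonneg (dist y m - dist a m)]

theorem exists_tendsto_of_dist_sq_le [HadamardSpace X] {z : ℕ → X} {C : ℝ}
    (h : ∀ k j, k ≤ j → dist (z k) (z j) ^ 2 ≤ C * (1 / ((k : ℝ) + 1))) :
    ∃ c, Tendsto z atTop (𝓝 c) := by
  have : CompleteSpace X := HadamardSpace.complete
  apply cauchySeq_tendsto_of_complete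
  refine cauchySeq_of_le_tendsto_0 (fun k : ℕ => 2 * √(C * (1 / ((k : ℝ) + 1)))) ?_ ?_
  · intro n m N hn hm
    have h1 := Real.le_sqrt_of_sq_le (h N n hn)
    have h2 := Real.le_sqrt_of_sq_le (h N m hm)
    have := dist_triangle_left (z n) (z m) (z N)
    linarith
  · have h1 := (tendsto_one_div_add_atTop_nhds_zero_nat (𝕜 := ℝ)).const_mul C
    have h2 := (h1.sqrt).const_mul 2
    simpa using h2

/-! ### The proximal problem: existence, uniqueness, nonexpansiveness -/

/-- `y` minimizes `f + d(x, ·)² / (2 r)`, expressed with real numbers. -/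
def IsProx (f : X → EReal) (r : ℝ) (x y : X) : Prop :=
  y ∈ dom f ∧ ∀ z ∈ dom f,
    2 * r * val f y + dist x y ^ 2 ≤ 2 * r * val f z + dist x z ^ 2

theorem IsProperConvexLsc.isMinOn_iff {f : X → EReal} (hf : IsProperConvexLsc f) {r : ℝ}
    (hr : 0 < r) (x y : X) : IsMinOn (proxFun f r x) Set.univ y ↔ IsProx f r x y := by
  have key : ∀ a b : X, a ∈ dom f → b ∈ dom f → (proxFun f r x a ≤ proxFun f r x b ↔
      2 * r * val f a + dist x a ^ 2 ≤ 2 * r * val f b + dist x b ^ 2) := by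
    intro a b ha hb
    unfold proxFun
    rw [← hf.coe_val ha, ← hf.coe_val hb, ← EReal.coe_add, ← EReal.coe_add, EReal.coe_le_coe_iff]
    have e : ∀ u v : ℝ, 2 * r * u + v = 2 * r * (u + v / (2 * r)) := by
      intro u v; field_simp
    rw [e, e, mul_le_mul_iff_right₀ (by positivity)]
  constructor
  · intro h
    have hy : y ∈ dom f := by
      obtain ⟨z, hz⟩ := hf.proper
      have h1 : proxFun f r x y ≤ proxFun f r x z := h (Set.mem_univ z)
      by_contra hy
      have hy' : f y = ⊤ := not_lt_top_iff.1 hy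
      unfold proxFun at h1
      rw [hy', ← hf.coe_val hz, EReal.top_add_coe, ← EReal.coe_add] at h1
      exact EReal.coe_ne_top _ (top_le_iff.1 h1)
    exact ⟨hy, fun z hz => (key y z hy hz).1 (h (Set.mem_univ z))⟩
  · rintro ⟨hy, h⟩ z -
    by_cases hz : z ∈ dom f
    · exact (key y z hy hz).2 (h z hz)
    · have hz' : f z = ⊤ := not_lt_top_iff.1 hz
      show proxFun f r x y ≤ proxFun f r x z
      conv_rhs => rw [proxFun, hz', EReal.top_add_coe]
      exact le_top

section prox

variable [HadamardSpace X] {f : X → EReal} {r : ℝ} {x y : X}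

/-- Compare `y` with the point at parameter `t` towards `z`, divide by `t` and let `t → 0`; the
CAT(0) correction term survives as `d(y, z)²`. -/
theorem IsProx.add_dist_sq_le (hf : IsProperConvexLsc f) (h : IsProx f r x y) (hr : 0 < r)
    {z : X} (hz : z ∈ dom f) :
    2 * r * val f y + dist x y ^ 2 + dist y z ^ 2 ≤ 2 * r * val f z + dist x z ^ 2 := by
  have key : ∀ t ∈ Set.Ioo (0 : ℝ) 1, 2 * r * val f y + dist x y ^ 2 + (1 - t) * dist y z ^ 2 ≤
      2 * r * val f z + dist x z ^ 2 := by
    intro t ht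
    obtain ⟨p, -, -, h1, h2⟩ := exists_point y z (t := t) ⟨ht.1.le, ht.2.le⟩
    obtain ⟨h3, h4⟩ := h2 f hf h.1 hz
    have h5 := h.2 p h3
    have h6 := h1 x
    have h7 := mul_le_mul_of_nonneg_left h4 (by positivity : 0 ≤ 2 * r)
    refine le_of_mul_le_mul_left ?_ ht.1
    linarith
  have h1 : Tendsto (fun t : ℝ => 2 * r * val f y + dist x y ^ 2 + (1 - t) * dist y z ^ 2)
      (𝓝[>] 0) (𝓝 (2 * r * val f y + dist x y ^ 2 + (1 - 0) * dist y z ^ 2)) := by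
    apply tendsto_nhdsWithin_of_tendsto_nhds
    apply Continuous.tendsto (f := fun t : ℝ =>
      2 * r * val f y + dist x y ^ 2 + (1 - t) * dist y z ^ 2)
    fun_prop
  have := le_of_tendsto h1 (Filter.mem_of_superset (Ioo_mem_nhdsGT one_pos) key)
  simpa using this

theorem IsProx.unique (hf : IsProperConvexLsc f) (hr : 0 < r) {y' : X}
    (h : IsProx f r x y) (h' : IsProx f r x y') : y = y' := by
  have h1 := h.add_dist_sq_le hf hr h'.1
  have h2 := h'.add_dist_sq_le hf hr h.1
  rw [dist_comm y' y] at h2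
  have : dist y y' ^ 2 ≤ 0 := by linarith
  exact dist_eq_zero.1 (pow_eq_zero_iff two_ne_zero |>.1 (le_antisymm this (sq_nonneg _)))

/-- Testing each minimizer against the other and adding cancels the values of `f`; the quadrilateral
inequality bounds what remains. -/
theorem IsProx.dist_le (hf : IsProperConvexLsc f) (hr : 0 < r) {x' y' : X}
    (h : IsProx f r x y) (h' : IsProx f r x' y') : dist y y' ≤ dist x x' := by
  have h1 := h.add_dist_sq_le hf hr h'.1
  have h2 := h'.add_dist_sq_le hf hr h.1
  rw [dist_comm y' y] at h2
  have h3 := dist_sq_add_dist_sq_le x x' y y'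
  exact le_of_sq_le_sq (by linarith) dist_nonneg

/-- A proper convex lsc function is bounded below by `-C (1 + d(x₀, ·))`. -/
theorem IsProperConvexLsc.exists_lower_bound (hf : IsProperConvexLsc f) :
    ∃ x₀ : X, ∃ A B : ℝ, ∀ z ∈ dom f, A - B * dist x₀ z ≤ val f z := by
  obtain ⟨x₀, hx₀⟩ := hf.proper
  have h1 : ((val f x₀ - 1 : ℝ) : EReal) < f x₀ := by
    rw [← hf.coe_val hx₀]
    exact_mod_cast sub_one_lt _
  obtain ⟨δ, hδ, hb⟩ := Metric.eventually_nhds_iff.1 (hf.lsc x₀ _ h1)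
  have hb' : ∀ z ∈ dom f, dist x₀ z < δ → val f x₀ - 1 < val f z := by
    intro z hz hd
    have : ((val f x₀ - 1 : ℝ) : EReal) < f z := hb (by rwa [dist_comm] at hd)
    rw [← hf.coe_val hz] at this
    exact_mod_cast this
  refine ⟨x₀, val f x₀ - 1, 2 / δ, fun z hz => ?_⟩
  rcases lt_or_ge (dist x₀ z) δ with hd | hd
  · have := hb' z hz hd
    have : 0 ≤ 2 / δ * dist x₀ z := by positivity
    linarith
  · have hD : 0 < dist x₀ z := hδ.trans_le hd
    -- This parameter gives the point at distance `δ/2` from `x₀` towards `z`, inside the ball where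
    -- `f` is bounded below; convexity carries the bound out to `z`.
    have ht0 : 0 < δ / (2 * dist x₀ z) := by positivity
    have ht1 : δ / (2 * dist x₀ z) ≤ 1 := by
      rw [div_le_one (by positivity)]; linarith
    obtain ⟨p, h2, -, -, h3⟩ := exists_point x₀ z ⟨ht0.le, ht1⟩
    obtain ⟨h4, h5⟩ := h3 f hf hx₀ hz
    have h6 := hb' p h4 (by rw [h2]; field_simp; linarith)
    have h7 : δ / (2 * dist x₀ z) * (2 / δ * dist x₀ z) = 1 := by field_simp
    refine le_of_mul_le_mul_left ?_ ht0
    nlinarith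

theorem IsProperConvexLsc.exists_isProx (hf : IsProperConvexLsc f) (hr : 0 < r) (x : X) :
    ∃ y, IsProx f r x y := by
  set h : X → ℝ := fun z => 2 * r * val f z + dist x z ^ 2 with hh
  have hne : (h '' dom f).Nonempty := hf.proper.image h
  have hbdd : BddBelow (h '' dom f) := by
    obtain ⟨x₀, A, B, hAB⟩ := hf.exists_lower_bound
    -- Completing the square: `s² - 2 r |B| s ≥ -(r |B|)²` with `s = d(x, z)`.
    refine ⟨2 * r * (A - |B| * dist x₀ x) - (r * |B|) ^ 2, ?_⟩
    rintro _ ⟨z, hz, rfl⟩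
    have h1 := hAB z hz
    have h2 : B * dist x₀ z ≤ |B| * (dist x₀ x + dist x z) :=
      mul_le_mul (le_abs_self B) (dist_triangle _ _ _) dist_nonneg (abs_nonneg B)
    have h3 := mul_le_mul_of_nonneg_left (by linarith : A - |B| * (dist x₀ x + dist x z) ≤ val f z)
      (by positivity : 0 ≤ 2 * r)
    simp only [hh]
    nlinarith [sq_nonneg (dist x z - r * |B|)]
  set m := sInf (h '' dom f) with hm
  have hlow : ∀ z ∈ dom f, m ≤ h z := fun z hz => csInf_le hbdd ⟨z, hz, rfl⟩
  have hex : ∀ k : ℕ, ∃ z ∈ dom f, h z < m + 1 / ((k : ℝ) + 1) := by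
    intro k
    obtain ⟨_, ⟨z, hz, rfl⟩, h1⟩ := exists_lt_of_csInf_lt hne
      (lt_add_of_pos_right m (by positivity : 0 < 1 / ((k : ℝ) + 1)))
    exact ⟨z, hz, h1⟩
  choose z hz hzm using hex
  obtain ⟨y, hy⟩ : ∃ c, Tendsto z atTop (𝓝 c) := by
    -- The objective at the midpoint of `z k` and `z j` is at least `m` and at most `m + 1/(k+1) -
    -- d(z k, z j)²/4`.
    apply exists_tendsto_of_dist_sq_le (C := 4)
    intro k j hkj
    obtain ⟨p, -, -, h1, h2⟩ := exists_point (z k) (z j) (t := 1 / 2) (by norm_num)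
    obtain ⟨h3, h4⟩ := h2 f hf (hz k) (hz j)
    have h5 := hlow p h3
    have h6 := h1 x
    have h7 := hzm k
    have h8 := hzm j
    have h9 : 1 / ((j : ℝ) + 1) ≤ 1 / ((k : ℝ) + 1) := by gcongr
    have h10 := mul_le_mul_of_nonneg_left h4 (by positivity : 0 ≤ 2 * r)
    simp only [hh] at h5 h7 h8
    linarith
  have hle : f y ≤ (((m - dist x y ^ 2) / (2 * r) : ℝ) : EReal) := by
    apply le_coe_of_forall_lt
    intro c hc
    rw [le_div_iff₀ (by positivity)]
    have h1 : ∀ᶠ k : ℕ in atTop, c * (2 * r) ≤ m + 1 / ((k : ℝ) + 1) - dist x (z k) ^ 2 := by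
      filter_upwards [hy.eventually (hf.lsc y _ hc)] with k hk
      rw [← hf.coe_val (hz k)] at hk
      have hk' : c < val f (z k) := by exact_mod_cast hk
      have h2 := hzm k
      simp only [hh] at h2
      nlinarith
    have h2 : Tendsto (fun k : ℕ => m + 1 / ((k : ℝ) + 1) - dist x (z k) ^ 2) atTop
        (𝓝 (m + 0 - dist x y ^ 2)) :=
      (tendsto_const_nhds.add tendsto_one_div_add_atTop_nhds_zero_nat).sub
        ((tendsto_const_nhds.dist hy).pow 2)
    rw [add_zero] at h2
    exact ge_of_tendsto h2 h1
  obtain ⟨hyd, hv⟩ := hf.val_le hle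
  refine ⟨y, hyd, fun w hw => ?_⟩
  rw [le_div_iff₀ (by positivity)] at hv
  have := hlow w hw
  simp only [hh] at this
  linarith

theorem IsProperConvexLsc.isProx_resolvent (hf : IsProperConvexLsc f) (hr : 0 < r) (x : X) :
    IsProx f r x (resolvent f r x) := by
  have h : 0 < r ∧ ∃ y, IsMinOn (proxFun f r x) Set.univ y := by
    obtain ⟨y, hy⟩ := hf.exists_isProx hr x
    exact ⟨hr, y, (hf.isMinOn_iff hr x y).2 hy⟩
  rw [resolvent, dif_pos h]
  exact (hf.isMinOn_iff hr x _).1 h.2.choose_spec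

theorem IsProperConvexLsc.isMinOn_iff_eq_resolvent (hf : IsProperConvexLsc f) (hr : 0 < r)
    (x y : X) : IsMinOn (proxFun f r x) Set.univ y ↔ y = resolvent f r x := by
  rw [hf.isMinOn_iff hr]
  exact ⟨fun h => h.unique hf hr (hf.isProx_resolvent hr x),
    fun h => h ▸ hf.isProx_resolvent hr x⟩

theorem IsProperConvexLsc.dist_resolvent_le (hf : IsProperConvexLsc f) (hr : 0 < r) (x y : X) :
    dist (resolvent f r x) (resolvent f r y) ≤ dist x y :=
  (hf.isProx_resolvent hr x).dist_le hf hr (hf.isProx_resolvent hr y)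

theorem IsProperConvexLsc.dist_iterate_resolvent_le (hf : IsProperConvexLsc f) (hr : 0 < r)
    (x y : X) (k : ℕ) : dist ((resolvent f r)^[k] x) ((resolvent f r)^[k] y) ≤ dist x y := by
  induction k with
  | zero => exact le_rfl
  | succ k ih =>
    rw [Function.iterate_succ_apply', Function.iterate_succ_apply']
    exact (hf.dist_resolvent_le hr _ _).trans ih

/-! ### Resolvent identity and comparison of implicit Euler schemes -/

/-- The resolvent identity. -/
theorem IsProperConvexLsc.resolvent_eq (hf : IsProperConvexLsc f) {l m : ℝ} (hm : 0 < m)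
    (hml : m ≤ l) {x z : X}
    (h1 : dist (resolvent f l x) z = m / l * dist (resolvent f l x) x)
    (h2 : dist z x = (1 - m / l) * dist (resolvent f l x) x) :
    resolvent f m z = resolvent f l x := by
  have hl : 0 < l := hm.trans_le hml
  have hp := hf.isProx_resolvent hl x
  set a := resolvent f l x
  refine (hf.isProx_resolvent hm z).unique hf hm ⟨hp.1, fun w hw => ?_⟩
  have h3 := hp.2 w hw
  have h4 : dist x w ^ 2 ≤ (dist z x + dist z w) ^ 2 := by
    gcongr; exact dist_triangle_left x w z
  rw [dist_comm z a, h1]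
  rw [dist_comm x a] at h3
  set D := dist a x
  obtain ⟨α, hα⟩ : ∃ α, α = m / l := ⟨_, rfl⟩
  have hm' : m = α * l := by rw [hα]; field_simp
  rw [← hα] at h1 h2 ⊢
  have hα0 : 0 < α := hα ▸ by positivity
  have hα1 : α ≤ 1 := by rw [hα, div_le_one hl]; exact hml
  rw [h2] at h4
  -- After `h4`, the slack is exactly `(1 - α) (d(z, w) - α D)²`.
  have h5 : α * dist x w ^ 2 ≤ α * (1 - α) * D ^ 2 + dist z w ^ 2 := by
    nlinarith [mul_nonneg (sub_nonneg.2 hα1) (sq_nonneg (dist z w - α * D)),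
      mul_le_mul_of_nonneg_left h4 hα0.le]
  have h6 := mul_le_mul_of_nonneg_left h3 hα0.le
  rw [hm']
  linarith

/-- By the resolvent identity `J_l x = J_m z` with `z` at distance `(m/l) d(x, J_l x)` from `J_l x`,
and `J_m` is nonexpansive. Thus the displacement per unit step size at `J_l x` is bounded for all
steps `m ≤ l`, as the Euler comparison requires. -/
theorem IsProperConvexLsc.dist_resolvent_resolvent_le (hf : IsProperConvexLsc f) {l m : ℝ}
    (hm : 0 < m) (hml : m ≤ l) (x : X) :
    dist (resolvent f l x) (resolvent f m (resolvent f l x)) ≤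
      m * (dist x (resolvent f l x) / l) := by
  have hl : 0 < l := hm.trans_le hml
  obtain ⟨z, h1, h2, -, -⟩ := exists_point (resolvent f l x) x (t := m / l)
    ⟨by positivity, (div_le_one hl).2 hml⟩
  have h3 := hf.dist_resolvent_le hm z (resolvent f l x)
  rw [hf.resolvent_eq hm hml h1 h2, dist_comm z, h1, dist_comm _ x] at h3
  calc _ ≤ _ := h3
    _ = _ := by ring

theorem IsProperConvexLsc.dist_iterate_le (hf : IsProperConvexLsc f) {l : ℝ} (hl : 0 < l)
    (y : X) (k : ℕ) : dist y ((resolvent f l)^[k] y) ≤ k * dist y (resolvent f l y) := by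
  induction k with
  | zero => simp
  | succ k ih =>
    have h1 := hf.dist_iterate_resolvent_le hl y (resolvent f l y) k
    rw [← Function.iterate_succ_apply] at h1
    have h2 := dist_triangle y ((resolvent f l)^[k] y) ((resolvent f l)^[k + 1] y)
    push_cast
    linarith

/-- Comparison of the implicit Euler schemes with step sizes `m ≤ l`. -/
theorem IsProperConvexLsc.dist_iterate_iterate_sq_le (hf : IsProperConvexLsc f) {l m s : ℝ}
    (hm : 0 < m) (hml : m ≤ l) {y : X} (hym : dist y (resolvent f m y) ≤ m * s)
    (hyl : dist y (resolvent f l y) ≤ l * s) (i k : ℕ) :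
    dist ((resolvent f m)^[i] y) ((resolvent f l)^[k] y) ^ 2 ≤
      s ^ 2 * ((i * m - k * l) ^ 2 + i * m * (l - m)) := by
  have hl : 0 < l := hm.trans_le hml
  induction i generalizing k with
  | zero =>
    have h1 : dist y ((resolvent f l)^[k] y) ≤ k * (l * s) :=
      (hf.dist_iterate_le hl y k).trans (by gcongr)
    have h2 : dist y ((resolvent f l)^[k] y) ^ 2 ≤ (k * (l * s)) ^ 2 := by gcongr
    simp only [Function.iterate_zero, id_eq, Nat.cast_zero]
    linarith
  | succ i ih =>
    cases k with
    | zero =>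
      have h1 : dist y ((resolvent f m)^[i + 1] y) ≤ ((i + 1 : ℕ) : ℝ) * (m * s) :=
        (hf.dist_iterate_le hm y (i + 1)).trans (by gcongr)
      have h2 : dist y ((resolvent f m)^[i + 1] y) ^ 2 ≤ (((i + 1 : ℕ) : ℝ) * (m * s)) ^ 2 := by
        gcongr
      have h3 : 0 ≤ s ^ 2 * (((i + 1 : ℕ) : ℝ) * m * (l - m)) := by
        have := sub_nonneg.2 hml
        positivity
      rw [dist_comm]
      simp only [Function.iterate_zero, id_eq, Nat.cast_zero]
      linarith
    | succ k =>
      have hα0 : 0 ≤ m / l := by positivity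
      have hα1 : m / l ≤ 1 := (div_le_one hl).2 hml
      -- One step of size `l` equals one step of size `m` from this `z`, so the bound at `(i+1,
      -- k+1)` is an average, with weights `1 - m/l` and `m/l`, of those at `(i, k+1)` and `(i, k)`.
      obtain ⟨z, h1, h2, h3, -⟩ := exists_point (resolvent f l ((resolvent f l)^[k] y))
        ((resolvent f l)^[k] y) ⟨hα0, hα1⟩
      have h4 := hf.resolvent_eq hm hml h1 h2
      rw [← Function.iterate_succ_apply' (resolvent f l)] at h3 h4
      have h5 := hf.dist_resolvent_le hm ((resolvent f m)^[i] y) z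
      rw [h4, ← Function.iterate_succ_apply' (resolvent f m)] at h5
      have h6 := h3 ((resolvent f m)^[i] y)
      have h7 : dist ((resolvent f m)^[i + 1] y) ((resolvent f l)^[k + 1] y) ^ 2 ≤
        dist ((resolvent f m)^[i] y) z ^ 2 := by gcongr
      have h8 := mul_le_mul_of_nonneg_left (ih k) hα0
      have h9 := mul_le_mul_of_nonneg_left (ih (k + 1)) (sub_nonneg.2 hα1)
      have h10 : 0 ≤ m / l * (1 - m / l) *
          dist ((resolvent f l)^[k + 1] y) ((resolvent f l)^[k] y) ^ 2 :=
        mul_nonneg (mul_nonneg hα0 (sub_nonneg.2 hα1)) (sq_nonneg _)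
      refine h7.trans (h6.trans ?_)
      -- The claimed bound satisfies this recursion with equality: `m (l - m)` is the variance of a
      -- step that is `l` with probability `m/l` and `0` otherwise.
      have e : s ^ 2 * ((((i + 1 : ℕ) : ℝ) * m - ((k + 1 : ℕ) : ℝ) * l) ^ 2
          + ((i + 1 : ℕ) : ℝ) * m * (l - m)) =
          (1 - m / l) * (s ^ 2 * ((i * m - ((k + 1 : ℕ) : ℝ) * l) ^ 2 + i * m * (l - m))) +
          m / l * (s ^ 2 * ((i * m - k * l) ^ 2 + i * m * (l - m))) := by
        push_cast
        field_simp
        ring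
      rw [e]
      linarith

end prox

/-! ### Existence of the semigroup and its stability -/

section flow

variable [HadamardSpace X] {f : X → EReal}

/-- Adding the two minimality inequalities shows that `f` is no larger at `J_m x` than at `J_l x`;
the growth inequality for `J_l x` tested at `J_m x` then loses its `f` terms. In particular `d(x,
J_l x)` is monotone in `l`. -/
theorem IsProperConvexLsc.dist_resolvent_resolvent_sq_le (hf : IsProperConvexLsc f) {l m : ℝ}
    (hl : 0 < l) (hlm : l ≤ m) (x : X) :
    dist (resolvent f l x) (resolvent f m x) ^ 2 ≤
      dist x (resolvent f m x) ^ 2 - dist x (resolvent f l x) ^ 2 := by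
  rcases hlm.eq_or_lt with rfl | hlm
  · simp
  have ha := hf.isProx_resolvent hl x
  have hb := hf.isProx_resolvent (hl.trans hlm) x
  have h1 := ha.add_dist_sq_le hf hl hb.1
  have h2 := ha.2 _ hb.1
  have h3 := hb.2 _ ha.1
  have h4 : val f (resolvent f m x) ≤ val f (resolvent f l x) := by
    refine le_of_mul_le_mul_left ?_ (sub_pos.2 hlm)
    linarith
  have h5 := mul_le_mul_of_nonneg_left h4 (by positivity : 0 ≤ 2 * l)
  linarith

/-- The resolvents `J_r x` form a Cauchy family as `r → 0`. -/
theorem IsProperConvexLsc.exists_dist_resolvent_lt (hf : IsProperConvexLsc f) (x : X) {ε : ℝ}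
    (hε : 0 < ε) : ∃ m > 0, ∀ l, 0 < l → l ≤ m →
      dist (resolvent f l x) (resolvent f m x) < ε := by
  set S : Set ℝ := (fun l => dist x (resolvent f l x) ^ 2) '' Set.Ioi 0
  have hb : BddBelow S := ⟨0, by rintro _ ⟨l, -, rfl⟩; positivity⟩
  have hS : S.Nonempty := ⟨_, 1, Set.mem_Ioi.2 one_pos, rfl⟩
  obtain ⟨_, ⟨m, hm, rfl⟩, h1⟩ := exists_lt_of_csInf_lt hS
    (lt_add_of_pos_right (sInf S) (by positivity : 0 < ε ^ 2))
  refine ⟨m, hm, fun l hl hlm => ?_⟩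
  have h2 := hf.dist_resolvent_resolvent_sq_le hl hlm x
  have h3 : sInf S ≤ dist x (resolvent f l x) ^ 2 := csInf_le hb ⟨l, hl, rfl⟩
  simp only at h1
  exact lt_of_pow_lt_pow_left₀ 2 hε.le (by linarith)

/-- For `w` in the domain and `r ≤ 1`, `f (J_1 w)` bounds `f (J_r w)` from below, so `d(w, J_r w)² ≤
2 r (f w - f (J_1 w))`. Nonexpansiveness transfers this to the closure. -/
theorem IsProperConvexLsc.exists_dist_self_resolvent_lt (hf : IsProperConvexLsc f) {x : X}
    (hx : x ∈ closure (dom f)) {ε : ℝ} (hε : 0 < ε) : ∃ r > 0, dist x (resolvent f r x) < ε := by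
  obtain ⟨w, hw, hxw⟩ := Metric.mem_closure_iff.1 hx (ε / 3) (by positivity)
  set C := val f w - val f (resolvent f 1 w)
  obtain ⟨r, hr0, hr1, hr⟩ : ∃ r : ℝ, 0 < r ∧ r ≤ 1 ∧ 2 * r * |C| < (ε / 3) ^ 2 := by
    have h1 : Tendsto (fun r : ℝ => 2 * r * |C|) (𝓝[>] 0) (𝓝 (2 * 0 * |C|)) :=
      tendsto_nhdsWithin_of_tendsto_nhds
        (Continuous.tendsto (f := fun r : ℝ => 2 * r * |C|) (by fun_prop) 0)
    rw [mul_zero, zero_mul] at h1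
    obtain ⟨r, h2, h3⟩ := ((h1.eventually_lt_const (by positivity : 0 < (ε / 3) ^ 2)).and
      (Ioc_mem_nhdsGT (one_pos : (0 : ℝ) < 1))).exists
    exact ⟨r, h3.1, h3.2, h2⟩
  refine ⟨r, hr0, ?_⟩
  have ha := hf.isProx_resolvent hr0 w
  have hb := hf.isProx_resolvent one_pos w
  have h2 := ha.2 w hw
  have h3 : val f (resolvent f 1 w) ≤ val f (resolvent f r w) := by
    have h4 := hf.dist_resolvent_resolvent_sq_le hr0 hr1 w
    have h5 := hb.2 _ ha.1
    nlinarith [sq_nonneg (dist (resolvent f r w) (resolvent f 1 w))]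
  rw [dist_self] at h2
  have h6 := mul_le_mul_of_nonneg_left
    (by linarith [le_abs_self C] : val f w - val f (resolvent f r w) ≤ |C|)
    (by positivity : 0 ≤ 2 * r)
  have h7 : dist w (resolvent f r w) < ε / 3 :=
    lt_of_pow_lt_pow_left₀ 2 (by positivity) (by linarith)
  have h8 := dist_triangle4 x w (resolvent f r w) (resolvent f r x)
  have h9 := hf.dist_resolvent_le hr0 w x
  rw [dist_comm w x] at h9
  linarith

theorem IsProperConvexLsc.dist_iterate_div_sq_le (hf : IsProperConvexLsc f) {r t : ℝ}
    (ht : 0 < t) (x : X) {k m : ℕ} (hk : 0 < k) (hkm : k ≤ m) (hr : t / k ≤ r) :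
    dist ((resolvent f (t / m))^[m] (resolvent f r x))
      ((resolvent f (t / k))^[k] (resolvent f r x)) ^ 2 ≤
      (dist x (resolvent f r x) / r) ^ 2 * (t ^ 2 / k) := by
  have hk' : (0 : ℝ) < k := by exact_mod_cast hk
  have hm' : (0 : ℝ) < m := by exact_mod_cast hk.trans_le hkm
  have h1 : t / m ≤ t / k := by gcongr
  refine (hf.dist_iterate_iterate_sq_le (by positivity) h1
    (hf.dist_resolvent_resolvent_le (by positivity) (h1.trans hr) x)
    (hf.dist_resolvent_resolvent_le (by positivity) hr x) m k).trans ?_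
  gcongr
  -- Both schemes reach the same time `t`, so only the variance term `t (t/k - t/m)` is left.
  rw [mul_div_cancel₀ _ hm'.ne', mul_div_cancel₀ _ hk'.ne']
  have : 0 ≤ t * (t / m) := by positivity
  calc _ = t * (t / k) - t * (t / m) := by ring
    _ ≤ t * (t / k) := by linarith
    _ = _ := by ring

/-- The exponential formula: the implicit Euler scheme converges from every starting point. -/
theorem IsProperConvexLsc.exists_tendsto_iterate (hf : IsProperConvexLsc f) {t : ℝ}
    (ht : 0 < t) (x : X) :
    ∃ y, Tendsto (fun k : ℕ => (resolvent f (t / k))^[k] x) atTop (𝓝 y) := by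
  have : CompleteSpace X := HadamardSpace.complete
  apply cauchySeq_tendsto_of_complete
  rw [Metric.cauchySeq_iff']
  intro ε hε
  obtain ⟨r, hr, h1⟩ := hf.exists_dist_resolvent_lt x (by positivity : 0 < ε / 8)
  set s := dist x (resolvent f r x) / r
  have htk : Tendsto (fun k : ℕ => t / k) atTop (𝓝 0) := tendsto_const_div_atTop_nhds_zero_nat t
  have h2 : ∀ᶠ k : ℕ in atTop, t / k * s < ε / 8 := by
    have := htk.mul_const s
    rw [zero_mul] at this
    exact this.eventually_lt_const (by positivity)
  have h3 : ∀ᶠ k : ℕ in atTop, s ^ 2 * (t ^ 2 / k) < (ε / 4) ^ 2 := by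
    have := (tendsto_const_div_atTop_nhds_zero_nat (t ^ 2)).const_mul (s ^ 2)
    rw [mul_zero] at this
    exact this.eventually_lt_const (by positivity)
  have h4 : ∀ᶠ k : ℕ in atTop, t / k ≤ r ∧ 0 < k :=
    (htk.eventually_le_const hr).and (eventually_gt_atTop 0)
  have h5 : ∀ᶠ k : ℕ in atTop, dist ((resolvent f (t / k))^[k] x)
      ((resolvent f (t / k))^[k] (resolvent f r x)) < ε / 4 := by
    filter_upwards [h2, h4] with k hk2 ⟨hkr, hk⟩
    have hk' : (0 : ℝ) < k := by exact_mod_cast hk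
    have h6 := h1 _ (by positivity) hkr
    have h7 := hf.dist_resolvent_resolvent_le (by positivity) hkr x
    -- The first step is split off because `x` may be far from the domain, hence from `J_r x`; after
    -- one small step both starting points are close to `J_r x`.
    obtain ⟨j, rfl⟩ : ∃ j, k = j + 1 := ⟨k - 1, by omega⟩
    rw [Function.iterate_succ_apply, Function.iterate_succ_apply]
    have h8 := hf.dist_iterate_resolvent_le (r := t / ((j + 1 : ℕ) : ℝ)) (by positivity)
      (resolvent f (t / ((j + 1 : ℕ) : ℝ)) x)
      (resolvent f (t / ((j + 1 : ℕ) : ℝ)) (resolvent f r x)) j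
    have h9 := dist_triangle (resolvent f (t / ((j + 1 : ℕ) : ℝ)) x) (resolvent f r x)
      (resolvent f (t / ((j + 1 : ℕ) : ℝ)) (resolvent f r x))
    linarith
  obtain ⟨N, hN⟩ := eventually_atTop.1 (h3.and (h4.and h5))
  refine ⟨N, fun m hm => ?_⟩
  obtain ⟨hN3, ⟨hNr, hN0⟩, hN5⟩ := hN N le_rfl
  have hm5 := (hN m hm).2.2
  have h6 := (hf.dist_iterate_div_sq_le ht x hN0 hm hNr).trans_lt hN3
  have h7 := lt_of_pow_lt_pow_left₀ 2 (by positivity) h6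
  have h8 := dist_triangle4 ((resolvent f (t / m))^[m] x)
    ((resolvent f (t / m))^[m] (resolvent f r x))
    ((resolvent f (t / N))^[N] (resolvent f r x)) ((resolvent f (t / N))^[N] x)
  rw [dist_comm ((resolvent f (t / N))^[N] (resolvent f r x))] at h8
  linarith

theorem IsProperConvexLsc.tendsto_semigroup (hf : IsProperConvexLsc f) {t : ℝ} (ht : 0 < t)
    (x : X) : Tendsto (fun k : ℕ => (resolvent f (t / k))^[k] x) atTop
      (𝓝 (semigroup f t x)) := by
  have h := hf.exists_tendsto_iterate ht x
  rw [semigroup, dif_pos h]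
  exact h.choose_spec

theorem IsProperConvexLsc.dist_semigroup_le (hf : IsProperConvexLsc f) {t : ℝ} (ht : 0 < t)
    (x y : X) : dist (semigroup f t x) (semigroup f t y) ≤ dist x y := by
  refine le_of_tendsto ((hf.tendsto_semigroup ht x).dist (hf.tendsto_semigroup ht y)) ?_
  filter_upwards [eventually_gt_atTop 0] with k hk
  have hk' : (0 : ℝ) < k := by exact_mod_cast hk
  exact hf.dist_iterate_resolvent_le (by positivity) x y k

theorem IsProperConvexLsc.dist_semigroup_iterate_sq_le (hf : IsProperConvexLsc f) {r t : ℝ}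
    (ht : 0 < t) (x : X) {k : ℕ} (hk : 0 < k) (hr : t / k ≤ r) :
    dist (semigroup f t (resolvent f r x))
      ((resolvent f (t / k))^[k] (resolvent f r x)) ^ 2 ≤
      (dist x (resolvent f r x) / r) ^ 2 * (t ^ 2 / k) := by
  refine le_of_tendsto (((hf.tendsto_semigroup ht _).dist tendsto_const_nhds).pow 2) ?_
  filter_upwards [eventually_ge_atTop k] with m hm
  exact hf.dist_iterate_div_sq_le ht x hk hm hr

theorem tendsto_semigroup_of_tendsto_resolvent {F : ℕ → X → EReal} (hf : IsProperConvexLsc f)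
    (hF : ∀ n, IsProperConvexLsc (F n))
    (h : ∀ x ∈ closure (dom f), ∀ r : ℝ, 0 < r →
      Tendsto (fun n => resolvent (F n) r x) atTop (𝓝 (resolvent f r x)))
    {x : X} (hx : x ∈ closure (dom f)) {t : ℝ} (ht : 0 < t) :
    Tendsto (fun n => semigroup (F n) t x) atTop (𝓝 (semigroup f t x)) := by
  rw [Metric.tendsto_nhds]
  intro ε hε
  obtain ⟨r, hr, hxr⟩ := hf.exists_dist_self_resolvent_lt hx (by positivity : 0 < ε / 5)
  -- The choice of `k` involves only `ε`, `r` and `t`, so it serves `f` and all `F n` with `n` large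
  -- at once.
  obtain ⟨k, hkr, hk, hks⟩ : ∃ k : ℕ, t / k ≤ r ∧ 0 < k ∧
      (ε / 5 / r) ^ 2 * (t ^ 2 / k) < (ε / 5) ^ 2 := by
    have h1 := (tendsto_const_div_atTop_nhds_zero_nat (t ^ 2)).const_mul ((ε / 5 / r) ^ 2)
    rw [mul_zero] at h1
    exact (((tendsto_const_div_atTop_nhds_zero_nat t).eventually_le_const hr).and
      ((eventually_gt_atTop 0).and (h1.eventually_lt_const (by positivity)))).exists
  have hk' : (0 : ℝ) < k := by exact_mod_cast hk
  have herr : ∀ g : X → EReal, IsProperConvexLsc g → dist x (resolvent g r x) < ε / 5 →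
      dist (semigroup g t x) ((resolvent g (t / k))^[k] (resolvent g r x)) < 2 * (ε / 5) := by
    intro g hg hd
    have h1 := hg.dist_semigroup_iterate_sq_le ht x hk hkr
    have h2 : (dist x (resolvent g r x) / r) ^ 2 * (t ^ 2 / k) ≤
      (ε / 5 / r) ^ 2 * (t ^ 2 / k) := by gcongr
    have h3 := lt_of_pow_lt_pow_left₀ 2 (by positivity) (h1.trans_lt (h2.trans_lt hks))
    have h4 := hg.dist_semigroup_le ht x (resolvent g r x)
    have h5 := dist_triangle (semigroup g t x) (semigroup g t (resolvent g r x))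
      ((resolvent g (t / k))^[k] (resolvent g r x))
    linarith
  -- The hypothesis applies only on the closure of `dom f`; the limiting iterates stay there because
  -- resolvents take values in `dom f`.
  have hiter : ∀ j : ℕ, (resolvent f (t / k))^[j] (resolvent f r x) ∈ closure (dom f) ∧
      Tendsto (fun n => (resolvent (F n) (t / k))^[j] (resolvent (F n) r x)) atTop
        (𝓝 ((resolvent f (t / k))^[j] (resolvent f r x))) := by
    intro j
    induction j with
    | zero => exact ⟨subset_closure (hf.isProx_resolvent hr x).1, h x hx r hr⟩
    | succ j ih =>
      have htk : 0 < t / k := by positivity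
      simp only [Function.iterate_succ_apply']
      refine ⟨subset_closure (hf.isProx_resolvent htk _).1, ?_⟩
      have h1 := h _ ih.1 _ htk
      rw [tendsto_iff_dist_tendsto_zero] at h1 ⊢
      have h2 := (tendsto_iff_dist_tendsto_zero.1 ih.2).add h1
      rw [add_zero] at h2
      refine squeeze_zero (fun _ => dist_nonneg) (fun n => ?_) h2
      refine (dist_triangle _ (resolvent (F n) (t / k)
        ((resolvent f (t / k))^[j] (resolvent f r x))) _).trans ?_
      gcongr
      exact (hF n).dist_resolvent_le htk _ _
  have h1 : ∀ᶠ n in atTop, dist x (resolvent (F n) r x) < ε / 5 :=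
    (tendsto_const_nhds.dist (h x hx r hr)).eventually_lt_const hxr
  have h2 := (Metric.tendsto_nhds.1 (hiter k).2) (ε / 5) (by positivity)
  filter_upwards [h1, h2] with n hn1 hn2
  have h3 := herr (F n) (hF n) hn1
  have h4 := herr f hf hxr
  have h5 := dist_triangle4 (semigroup (F n) t x)
    ((resolvent (F n) (t / k))^[k] (resolvent (F n) r x))
    ((resolvent f (t / k))^[k] (resolvent f r x)) (semigroup f t x)
  rw [dist_comm ((resolvent f (t / k))^[k] (resolvent f r x))] at h5
  linarith

end flow

/-! ### Weak convergence and asymptotic centers -/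

/-- This `ε`-form of the center property avoids upper limits: it passes to subsequences and survives
filling gaps in a sequence. -/
theorem weaklyTendsto_of_eventually_le {u : ℕ → X} {c : X}
    (hb : Bornology.IsBounded (Set.range u))
    (h : ∀ y, ∀ ε > 0, ∀ᶠ n in atTop, dist c (u n) ^ 2 ≤ dist y (u n) ^ 2 + ε) :
    WeaklyTendsto u c := by
  refine ⟨hb, fun φ hφ y _ => ?_⟩
  obtain ⟨R, hR⟩ := (Metric.isBounded_iff_subset_closedBall y).1 hb
  have hbdd : IsBoundedUnder (· ≤ ·) atTop (fun n => dist y ((u ∘ φ) n) ^ 2) := by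
    refine isBoundedUnder_of ⟨R ^ 2, fun n => ?_⟩
    have := hR ⟨φ n, rfl⟩
    rw [Metric.mem_closedBall, dist_comm] at this
    show dist y (u (φ n)) ^ 2 ≤ R ^ 2
    gcongr
  have hcob : IsCoboundedUnder (· ≤ ·) atTop (fun n => dist c ((u ∘ φ) n) ^ 2) :=
    (isBoundedUnder_of ⟨0, fun n => sq_nonneg _⟩ :
      IsBoundedUnder (· ≥ ·) atTop (fun n => dist c ((u ∘ φ) n) ^ 2)).isCoboundedUnder_le
  show limsup (fun n => dist c ((u ∘ φ) n) ^ 2) atTop ≤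
    limsup (fun n => dist y ((u ∘ φ) n) ^ 2) atTop
  refine le_of_forall_pos_le_add fun ε hε => ?_
  refine limsup_le_of_le hcob ?_
  filter_upwards [hφ.tendsto_atTop.eventually (h y (ε / 2) (by positivity)),
    eventually_lt_of_limsup_lt (lt_add_of_pos_right (limsup (fun n => dist y ((u ∘ φ) n) ^ 2) atTop)
      (by positivity : 0 < ε / 2)) hbdd]
    with n h1 h2
  simp only [Function.comp_apply] at h2 ⊢
  linarith

theorem weaklyTendsto_of_tendsto {u : ℕ → X} {c : X} (h : Tendsto u atTop (𝓝 c)) :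
    WeaklyTendsto u c := by
  refine weaklyTendsto_of_eventually_le (Metric.isBounded_range_of_tendsto u h) fun y ε hε => ?_
  have h1 := ((tendsto_const_nhds (x := c)).dist h).pow 2
  rw [dist_self, zero_pow two_ne_zero] at h1
  filter_upwards [h1.eventually_lt_const hε] with n hn
  have := sq_nonneg (dist y (u n))
  linarith

/-- Upper bounds of the squared distance from some point to the tail of `u` along `A`. -/
def radiusSet (u : ℕ → X) (A : Set ℕ) : Set ℝ :=
  {ρ | ∃ y, ∀ᶠ n in atTop, n ∈ A → dist y (u n) ^ 2 ≤ ρ}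

theorem radiusSet_subset {u : ℕ → X} {A B : Set ℕ} (h : ∀ᶠ n in atTop, n ∈ B → n ∈ A) :
    radiusSet u A ⊆ radiusSet u B := by
  rintro ρ ⟨y, hy⟩
  refine ⟨y, ?_⟩
  filter_upwards [h, hy] with n h1 h2 h3 using h2 (h1 h3)

theorem bddBelow_radiusSet (u : ℕ → X) {A : Set ℕ} (hA : A.Infinite) :
    BddBelow (radiusSet u A) := by
  refine ⟨0, ?_⟩
  rintro ρ ⟨y, hy⟩
  obtain ⟨n, hn, h⟩ := ((Nat.frequently_atTop_iff_infinite.2 hA).and_eventually hy).exists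
  exact (sq_nonneg _).trans (h hn)

theorem nonempty_radiusSet {u : ℕ → X} (hu : Bornology.IsBounded (Set.range u)) (A : Set ℕ) :
    (radiusSet u A).Nonempty := by
  obtain ⟨R, hR⟩ := (Metric.isBounded_iff_subset_closedBall (u 0)).1 hu
  refine ⟨R ^ 2, u 0, Eventually.of_forall fun n _ => ?_⟩
  have := hR ⟨n, rfl⟩
  rw [Metric.mem_closedBall, dist_comm] at this
  gcongr

theorem sInf_radiusSet_le {u : ℕ → X} (hu : Bornology.IsBounded (Set.range u)) {A B : Set ℕ}
    (hB : B.Infinite) (h : ∀ᶠ n in atTop, n ∈ B → n ∈ A) :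
    sInf (radiusSet u B) ≤ sInf (radiusSet u A) :=
  csInf_le_csInf (bddBelow_radiusSet u hB) (nonempty_radiusSet hu A) (radiusSet_subset h)

/-- Passing to a subsequence can only lower the asymptotic radius; `A'` nearly attains the infimum
over all infinite subsets of `A`. -/
theorem exists_almost_regular {u : ℕ → X} (hu : Bornology.IsBounded (Set.range u)) {A : Set ℕ}
    (hA : A.Infinite) {ε : ℝ} (hε : 0 < ε) : ∃ A' ⊆ A, A'.Infinite ∧ ∀ B ⊆ A', B.Infinite →
      sInf (radiusSet u A') ≤ sInf (radiusSet u B) + ε := by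
  set S : Set ℝ := (fun B => sInf (radiusSet u B)) '' {B | B ⊆ A ∧ B.Infinite}
  have hb : BddBelow S := by
    refine ⟨0, ?_⟩
    rintro _ ⟨B, ⟨-, hB⟩, rfl⟩
    refine le_csInf (nonempty_radiusSet hu B) ?_
    rintro ρ ⟨y, hy⟩
    obtain ⟨n, hn, h⟩ := ((Nat.frequently_atTop_iff_infinite.2 hB).and_eventually hy).exists
    exact (sq_nonneg _).trans (h hn)
  obtain ⟨_, ⟨A', ⟨hA', hinf⟩, rfl⟩, h1⟩ := exists_lt_of_csInf_lt
    (⟨_, A, ⟨subset_rfl, hA⟩, rfl⟩ : S.Nonempty) (lt_add_of_pos_right (sInf S) hε)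
  refine ⟨A', hA', hinf, fun B hB hBinf => ?_⟩
  have h2 : sInf S ≤ sInf (radiusSet u B) := csInf_le hb ⟨B, ⟨hB.trans hA', hBinf⟩, rfl⟩
  simp only at h1
  linarith

/-- Every bounded sequence has a regular subsequence: all of its subsequences have the same
asymptotic radius. -/
theorem exists_regular {u : ℕ → X} (hu : Bornology.IsBounded (Set.range u)) :
    ∃ φ : ℕ → ℕ, StrictMono φ ∧ ∀ B ⊆ Set.range φ, B.Infinite →
      sInf (radiusSet u (Set.range φ)) ≤ sInf (radiusSet u B) := by
  have hstep : ∀ (k : ℕ) (A : {A : Set ℕ // A.Infinite}), ∃ A' : {A : Set ℕ // A.Infinite},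
      A'.1 ⊆ A.1 ∧ ∀ B ⊆ A'.1, B.Infinite →
        sInf (radiusSet u A'.1) ≤ sInf (radiusSet u B) + 1 / ((k : ℝ) + 1) := by
    intro k A
    obtain ⟨A', h1, h2, h3⟩ := exists_almost_regular hu A.2
      (by positivity : 0 < 1 / ((k : ℝ) + 1))
    exact ⟨⟨A', h2⟩, h1, h3⟩
  choose next hsub hreg using hstep
  let A : ℕ → {A : Set ℕ // A.Infinite} := fun k =>
    Nat.rec ⟨Set.univ, Set.infinite_univ⟩ (fun k A => next k A) k
  have hanti : Antitone fun k => (A k).1 := antitone_nat_of_succ_le fun k => hsub k (A k)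
  obtain ⟨φ, hφ, hφA⟩ := extraction_forall_of_frequently
    (fun k => Nat.frequently_atTop_iff_infinite.2 (A k).2)
  -- Diagonal argument: from `φ k` on, the range of `φ` lies in `A k`, and `A (k + 1)` is regular up
  -- to `1/(k+1)`.
  have htail : ∀ k n, φ k ≤ n → n ∈ Set.range φ → n ∈ (A k).1 := by
    rintro k _ hn ⟨j, rfl⟩
    exact hanti (hφ.le_iff_le.1 hn) (hφA j)
  refine ⟨φ, hφ, fun B hB hBinf => ?_⟩
  have key : ∀ k : ℕ, sInf (radiusSet u (Set.range φ)) ≤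
      sInf (radiusSet u B) + 1 / ((k : ℝ) + 1) := by
    intro k
    have hB' : (B ∩ Set.Ici (φ (k + 1))).Infinite := by
      have : (B \ Set.Iio (φ (k + 1))).Infinite := hBinf.sdiff (Set.finite_Iio _)
      refine this.mono fun n hn => ⟨hn.1, ?_⟩
      simpa using hn.2
    have h1 : sInf (radiusSet u (Set.range φ)) ≤ sInf (radiusSet u (A (k + 1)).1) := by
      refine sInf_radiusSet_le hu (Set.infinite_range_of_injective hφ.injective) ?_
      filter_upwards [eventually_ge_atTop (φ (k + 1))] with n hn hn' using htail _ _ hn hn'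
    have h2 := hreg k (A k) (B ∩ Set.Ici (φ (k + 1)))
      (fun n hn => htail (k + 1) n hn.2 (hB hn.1)) hB'
    have h3 : sInf (radiusSet u (B ∩ Set.Ici (φ (k + 1)))) ≤ sInf (radiusSet u B) :=
      sInf_radiusSet_le hu hB' (Eventually.of_forall fun n hn => hn.1)
    exact h1.trans (h2.trans (by gcongr))
  refine ge_of_tendsto' (x := atTop) ?_ key
  simpa using (tendsto_one_div_add_atTop_nhds_zero_nat (𝕜 := ℝ)).const_add
    (sInf (radiusSet u B))

/-- Weak sequential compactness of bounded sets. -/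
theorem exists_subseq_eventually_le [HadamardSpace X] {u : ℕ → X}
    (hu : Bornology.IsBounded (Set.range u)) :
    ∃ φ : ℕ → ℕ, StrictMono φ ∧ ∃ c : X, ∀ y, ∀ ε > 0, ∀ᶠ k in atTop,
      dist c (u (φ k)) ^ 2 ≤ dist y (u (φ k)) ^ 2 + ε := by
  obtain ⟨φ, hφ, hreg⟩ := exists_regular hu
  refine ⟨φ, hφ, ?_⟩
  set A := Set.range φ
  have hA : A.Infinite := Set.infinite_range_of_injective hφ.injective
  set ρ := sInf (radiusSet u A)
  have hex : ∀ k : ℕ, ∃ y, ∀ᶠ n in atTop, n ∈ A →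
      dist y (u n) ^ 2 ≤ ρ + 1 / ((k : ℝ) + 1) := by
    intro k
    obtain ⟨σ, ⟨y, hy⟩, hσ⟩ := exists_lt_of_csInf_lt (nonempty_radiusSet hu A)
      (lt_add_of_pos_right ρ (by positivity : 0 < 1 / ((k : ℝ) + 1)))
    refine ⟨y, ?_⟩
    filter_upwards [hy] with n hn hn' using (hn hn').trans hσ.le
  choose z hz using hex
  obtain ⟨c, hc⟩ : ∃ c, Tendsto z atTop (𝓝 c) := by
    apply exists_tendsto_of_dist_sq_le (C := 4)
    intro k j hkj
    obtain ⟨p, -, -, h1, -⟩ := exists_point (z k) (z j) (t := 1 / 2) (by norm_num)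
    have h2 : ρ ≤ ρ + 1 / ((k : ℝ) + 1) - 1 / 4 * dist (z k) (z j) ^ 2 := by
      refine csInf_le (bddBelow_radiusSet u hA) ⟨p, ?_⟩
      filter_upwards [hz k, hz j] with n h3 h4 hn
      have h5 := h1 (u n)
      have h6 : 1 / ((j : ℝ) + 1) ≤ 1 / ((k : ℝ) + 1) := by gcongr
      have h7 := h3 hn
      have h8 := h4 hn
      rw [dist_comm (u n) p, dist_comm (u n) (z k), dist_comm (u n) (z j)] at h5
      linarith
    linarith
  have hcρ : ∀ ε > 0, ∀ᶠ n in atTop, n ∈ A → dist c (u n) ^ 2 ≤ ρ + ε := by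
    intro ε hε
    obtain ⟨R, hR⟩ := (Metric.isBounded_iff_subset_closedBall c).1 hu
    -- With `e = d(c, z k)` and `d(z k, u n) ≤ R + e`, replacing `z k` by `c` raises the squared
    -- distance by at most `e (2 R + 3 e)`.
    have hlim : Tendsto (fun k : ℕ => 1 / ((k : ℝ) + 1) + dist c (z k) * (2 * R + 3 * dist c (z k)))
        atTop (𝓝 0) := by
      have h1 := (tendsto_const_nhds (x := c)).dist hc
      rw [dist_self] at h1
      simpa using tendsto_one_div_add_atTop_nhds_zero_nat.add (h1.mul ((h1.const_mul 3).const_add (2 * R)))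
    obtain ⟨k, hk⟩ := (hlim.eventually_lt_const hε).exists
    filter_upwards [hz k] with n hn hnA
    have h1 := hn hnA
    have h2 := hR ⟨n, rfl⟩
    rw [Metric.mem_closedBall, dist_comm] at h2
    have h3 := dist_triangle_left (z k) (u n) c
    have h4 := dist_triangle c (z k) (u n)
    have h5 : dist c (u n) ^ 2 ≤ (dist c (z k) + dist (z k) (u n)) ^ 2 := by gcongr
    nlinarith [dist_nonneg (x := c) (y := z k)]
  refine ⟨c, fun y ε hε => ?_⟩
  by_contra hcon
  -- Along `B` the point `y` beats `c` by `ε`, so the radius falls below `ρ`, contradicting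
  -- regularity.
  set B : Set ℕ := {n ∈ A | dist y (u n) ^ 2 + ε < dist c (u n) ^ 2}
  have hB : B.Infinite := by
    rw [← Nat.frequently_atTop_iff_infinite]
    have h1 : ∃ᶠ k in atTop, φ k ∈ B := by
      refine (not_eventually.1 hcon).mono fun k hk => ⟨⟨k, rfl⟩, not_le.1 hk⟩
    exact hφ.tendsto_atTop.frequently h1
  have h1 := hreg B (fun n hn => hn.1) hB
  have h2 : sInf (radiusSet u B) ≤ ρ - ε / 2 := by
    refine csInf_le (bddBelow_radiusSet u hB) ⟨y, ?_⟩
    filter_upwards [hcρ (ε / 2) (by positivity)] with n hn hnB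
    have h3 := hn hnB.1
    have h4 := hnB.2
    linarith
  linarith

/-- An asymptotic center satisfies the stronger inequality with the term `d(c, y)²`. -/
theorem eventually_add_dist_sq_le [HadamardSpace X] {ι : Type*} {l : Filter ι} {u : ι → X} {c : X}
    (h : ∀ y, ∀ ε > 0, ∀ᶠ k in l, dist c (u k) ^ 2 ≤ dist y (u k) ^ 2 + ε)
    (y : X) {ε : ℝ} (hε : 0 < ε) :
    ∀ᶠ k in l, dist c (u k) ^ 2 + dist c y ^ 2 ≤ dist y (u k) ^ 2 + ε := by
  obtain ⟨t, ht0, ht1, ht⟩ : ∃ t : ℝ, 0 < t ∧ t ≤ 1 ∧ t * dist c y ^ 2 ≤ ε / 2 := by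
    refine ⟨min 1 (ε / 2 / (dist c y ^ 2 + 1)), lt_min one_pos (by positivity), min_le_left _ _, ?_⟩
    calc _ ≤ ε / 2 / (dist c y ^ 2 + 1) * (dist c y ^ 2 + 1) := by
          gcongr
          · exact min_le_right _ _
          · linarith
      _ = ε / 2 := by field_simp
  obtain ⟨p, -, -, h1, -⟩ := exists_point c y ⟨ht0.le, ht1⟩
  -- The tolerance `t ε/2` becomes `ε/2` after division by `t`; the other half absorbs `t d(c, y)²`.
  filter_upwards [h p (t * (ε / 2)) (by positivity)] with k hk
  have h2 := h1 (u k)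
  rw [dist_comm (u k) p, dist_comm (u k) c, dist_comm (u k) y] at h2
  have h3 : t * (dist c (u k) ^ 2 + (1 - t) * dist c y ^ 2) ≤
      t * (dist y (u k) ^ 2 + ε / 2) := by linarith
  have h4 := le_of_mul_le_mul_left h3 ht0
  linarith

/-! ### Mosco convergence implies convergence of resolvents -/

section mosco

variable {f : X → EReal} {F : ℕ → X → EReal}

theorem MoscoTendsto.eventually_lt (h : MoscoTendsto F f) {u : ℕ → X} {x : X}
    (hu : WeaklyTendsto u x) {c : ℝ} (hc : (c : EReal) < f x) :
    ∀ᶠ n in atTop, (c : EReal) < F n (u n) :=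
  eventually_lt_of_lt_liminf (hc.trans_le ((h x).1 u hu))

theorem MoscoTendsto.exists_recovery (h : MoscoTendsto F f) (hf : IsProperConvexLsc f)
    {x : X} (hx : x ∈ dom f) :
    ∃ y : ℕ → X, Tendsto y atTop (𝓝 x) ∧ (∀ᶠ n in atTop, y n ∈ dom (F n)) ∧
      Tendsto (fun n => val (F n) (y n)) atTop (𝓝 (val f x)) := by
  obtain ⟨y, hy, hFy⟩ := (h x).2
  exact ⟨y, hy, hFy.eventually_lt_const hx,
    (EReal.tendsto_toReal (ne_of_lt hx) (hf.ne_bot x)).comp hFy⟩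

/-- By nonexpansiveness it suffices to bound the displacement `D n` of a recovery sequence `y n →
x₀`. Were it unbounded, points arbitrarily near `y n` would have values lower by `1/r`, giving a
sequence converging to `x₀` that violates (M1). -/
theorem MoscoTendsto.isBounded_range_resolvent [HadamardSpace X] (h : MoscoTendsto F f) (hf : IsProperConvexLsc f)
    (hF : ∀ n, IsProperConvexLsc (F n)) {r : ℝ} (hr : 0 < r) (x : X) :
    Bornology.IsBounded (Set.range fun n => resolvent (F n) r x) := by
  obtain ⟨x₀, hx₀⟩ := hf.proper
  obtain ⟨y, hy, hyd, hyv⟩ := h.exists_recovery hf hx₀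
  set D : ℕ → ℝ := fun n => dist (y n) (resolvent (F n) r (y n)) with hD
  suffices hbd : ∃ K, ∀ᶠ n in atTop, D n ≤ K by
    obtain ⟨K, hK⟩ := hbd
    have h1 : ∀ᶠ n in atTop, dist x₀ (resolvent (F n) r x) ≤ 1 + K + (1 + dist x₀ x) := by
      have h2 := Metric.tendsto_nhds.1 hy 1 one_pos
      filter_upwards [hK, h2] with n hn hn2
      have h3 := dist_triangle4 x₀ (y n) (resolvent (F n) r (y n)) (resolvent (F n) r x)
      have h4 := (hF n).dist_resolvent_le hr (y n) x
      have h5 := dist_triangle (y n) x₀ x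
      rw [dist_comm x₀ (y n)] at h3
      simp only [hD] at hn
      linarith
    obtain ⟨N, hN⟩ := eventually_atTop.1 h1
    have h2 : (Set.range fun n => resolvent (F n) r x) ⊆
        ((fun n => resolvent (F n) r x) '' Set.Iio N) ∪
          Metric.closedBall x₀ (1 + K + (1 + dist x₀ x)) := by
      rintro _ ⟨n, rfl⟩
      rcases lt_or_ge n N with hn | hn
      · exact Or.inl ⟨n, hn, rfl⟩
      · right
        rw [Metric.mem_closedBall, dist_comm]
        exact hN n hn
    exact ((((Set.finite_Iio N).image _).isBounded).union Metric.isBounded_closedBall).subset h2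
  by_contra! hcon
  have hfreq : ∀ k : ℕ, ∃ᶠ n in atTop, (k : ℝ) + 1 < D n := fun k =>
    (hcon (k + 1)).mono fun n hn => hn
  obtain ⟨θ, hθ, hθD⟩ := extraction_forall_of_frequently hfreq
  -- On the way from `y n` to its resolvent the value of `F n` drops by `1 / r` within
  -- distance `1 / D n`.
  have hz : ∀ n, ∃ z : X, 1 ≤ D n → dist (y n) z ≤ 1 / D n ∧
      (y n ∈ dom (F n) → z ∈ dom (F n) ∧ val (F n) z ≤ val (F n) (y n) - 1 / r) := by
    intro n
    rcases lt_or_ge (D n) 1 with hn | hn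
    · exact ⟨y n, fun h => absurd h (not_le.2 hn)⟩
    · have hpos : 0 < D n := one_pos.trans_le hn
      have ht1 : 1 / D n ^ 2 ≤ 1 := by
        rw [div_le_one (by positivity)]
        exact one_le_pow₀ hn
      obtain ⟨z, h1, -, -, h2⟩ := exists_point (y n) (resolvent (F n) r (y n))
        (t := 1 / D n ^ 2) ⟨by positivity, ht1⟩
      refine ⟨z, fun _ => ⟨?_, fun hyn => ?_⟩⟩
      · rw [h1]
        show 1 / D n ^ 2 * D n ≤ _
        apply le_of_eq
        field_simp
      · have hp := (hF n).isProx_resolvent hr (y n)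
        obtain ⟨h3, h4⟩ := h2 (F n) (hF n) hyn hp.1
        refine ⟨h3, h4.trans ?_⟩
        -- Tested at `y n` itself, the growth inequality contains `D n ^ 2` twice, whence a drop of
        -- `D n ^ 2 / r`.
        have h5 := hp.add_dist_sq_le (hF n) hr hyn
        rw [dist_self, dist_comm (resolvent (F n) r (y n)) (y n)] at h5
        have h6 : 2 * r * val (F n) (resolvent (F n) r (y n)) + D n ^ 2 + D n ^ 2 ≤
          2 * r * val (F n) (y n) + 0 ^ 2 := h5
        have h7 : val (F n) (resolvent (F n) r (y n)) ≤ val (F n) (y n) - D n ^ 2 / r := by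
          rw [le_sub_iff_add_le, ← le_sub_iff_add_le', div_le_iff₀ hr]
          linarith
        have h8 := mul_le_mul_of_nonneg_left h7 (by positivity : 0 ≤ 1 / D n ^ 2)
        have h9 : 1 / D n ^ 2 * (D n ^ 2 / r) = 1 / r := by field_simp
        linarith
  choose z hz using hz
  have hD1 : ∀ k, 1 ≤ D (θ k) := fun k =>
    le_trans (by linarith [k.cast_nonneg (α := ℝ)]) (hθD k).le
  classical
  -- (M1) concerns full sequences, so the gaps are filled with `y n`, which also tends to `x₀`.
  set w : ℕ → X := fun n => if n ∈ Set.range θ then z n else y n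
  have hw : Tendsto w atTop (𝓝 x₀) := by
    rw [Metric.tendsto_nhds]
    intro ε hε
    obtain ⟨K, hK⟩ := exists_nat_one_div_lt (by positivity : 0 < ε / 2)
    filter_upwards [eventually_ge_atTop (θ K), Metric.tendsto_nhds.1 hy (ε / 2) (by positivity)]
      with n hn hyn
    have hwy : dist (w n) (y n) < ε / 2 := by
      by_cases hnθ : n ∈ Set.range θ
      · have hwn : w n = z n := if_pos hnθ
        obtain ⟨k, rfl⟩ := hnθ
        rw [hwn, dist_comm]
        refine ((hz _ (hD1 k)).1.trans ?_).trans_lt hK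
        have hKk : (K : ℝ) ≤ k := by exact_mod_cast hθ.le_iff_le.1 hn
        have := hθD k
        gcongr
        linarith
      · have hwn : w n = y n := if_neg hnθ
        rw [hwn, dist_self]
        positivity
    have := dist_triangle (w n) (y n) x₀
    linarith
  have hlt : ((val f x₀ - 1 / r / 2 : ℝ) : EReal) < f x₀ := by
    rw [← hf.coe_val hx₀]
    exact_mod_cast sub_lt_self _ (by positivity)
  have hθt := hθ.tendsto_atTop
  have hev : ∀ᶠ k in atTop, val f x₀ - 1 / r / 2 ≤ val (F (θ k)) (y (θ k)) - 1 / r := by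
    filter_upwards [hθt.eventually (h.eventually_lt (weaklyTendsto_of_tendsto hw) hlt),
      hθt.eventually hyd] with k h1 h2
    have hwk : w (θ k) = z (θ k) := if_pos ⟨k, rfl⟩
    obtain ⟨h3, h4⟩ := (hz _ (hD1 k)).2 h2
    rw [hwk, ← (hF _).coe_val h3] at h1
    have h5 : val f x₀ - 1 / r / 2 < val (F (θ k)) (z (θ k)) := by exact_mod_cast h1
    linarith
  have h1 := ge_of_tendsto ((hyv.comp hθt).sub_const (1 / r)) hev
  have h2 : 0 < 1 / r := by positivity
  linarith

/-- The growth inequality for `J^n_r x`, tested at a recovery sequence of `a = J_r x`, carries an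
extra `(δ/2)²` if `J^n_r x` stays `δ` away from `a`. By (M1) this gain passes to a weak limit `c`,
contradicting minimality of `a`; that `c = a` is never needed. -/
theorem MoscoTendsto.tendsto_resolvent [HadamardSpace X] (h : MoscoTendsto F f) (hf : IsProperConvexLsc f)
    (hF : ∀ n, IsProperConvexLsc (F n)) {r : ℝ} (hr : 0 < r) (x : X) :
    Tendsto (fun n => resolvent (F n) r x) atTop (𝓝 (resolvent f r x)) := by
  by_contra hcon
  set u : ℕ → X := fun n => resolvent (F n) r x
  set a := resolvent f r x
  have ha : IsProx f r x a := hf.isProx_resolvent hr x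
  obtain ⟨δ, hδ, hfr⟩ : ∃ δ > 0, ∃ᶠ n in atTop, δ ≤ dist (u n) a := by
    rw [Metric.tendsto_nhds] at hcon
    push Not at hcon
    exact hcon
  obtain ⟨φ, hφ, hφδ⟩ := extraction_of_frequently_atTop hfr
  have hub := h.isBounded_range_resolvent hf hF hr x
  obtain ⟨ψ, hψ, c, hc⟩ := exists_subseq_eventually_le (u := u ∘ φ)
    (hub.subset (Set.range_comp_subset_range φ u))
  set θ := φ ∘ ψ
  have hθ : StrictMono θ := hφ.comp hψ
  have hc' : ∀ y, ∀ ε > 0, ∀ᶠ k in atTop, dist c (u (θ k)) ^ 2 ≤ dist y (u (θ k)) ^ 2 + ε := hc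
  classical
  -- Filling the gaps of the subsequence with `c` gives a weakly convergent sequence.
  set w : ℕ → X := fun n => if n ∈ Set.range θ then u n else c
  have hwθ : ∀ k, w (θ k) = u (θ k) := fun k => if_pos ⟨k, rfl⟩
  have hweak : WeaklyTendsto w c := by
    apply weaklyTendsto_of_eventually_le
    · refine (hub.union (Bornology.isBounded_singleton (x := c))).subset ?_
      rintro _ ⟨n, rfl⟩
      by_cases hn : n ∈ Set.range θ
      · exact Or.inl ⟨n, (if_pos hn).symm⟩
      · exact Or.inr (if_neg hn)
    · intro y ε hε
      obtain ⟨K, hK⟩ := eventually_atTop.1 (hc' y ε hε)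
      filter_upwards [eventually_ge_atTop (θ K)] with n hn
      by_cases hnθ : n ∈ Set.range θ
      · obtain ⟨k, rfl⟩ := hnθ
        rw [hwθ]
        exact hK k (hθ.le_iff_le.1 hn)
      · have : w n = c := if_neg hnθ
        rw [this, dist_self]
        have := sq_nonneg (dist y c)
        linarith
  obtain ⟨y, hy, hyd, hyv⟩ := h.exists_recovery hf ha.1
  have hθt := hθ.tendsto_atTop
  have key : f c ≤ (((2 * r * val f a + dist x a ^ 2 - (δ / 2) ^ 2 - dist c x ^ 2) / (2 * r) : ℝ) :
      EReal) := by
    apply le_coe_of_forall_lt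
    intro b hb
    rw [le_div_iff₀ (by positivity)]
    -- The `ε` pays for `d(c, x)² ≤ d(x, u (θ k))² + ε`, which the asymptotic center gives only
    -- eventually.
    refine le_of_forall_pos_le_add fun ε hε => ?_
    have hlim : Tendsto (fun k => 2 * r * val (F (θ k)) (y (θ k)) + dist x (y (θ k)) ^ 2 + ε
        - (δ / 2) ^ 2 - dist c x ^ 2) atTop
        (𝓝 (2 * r * val f a + dist x a ^ 2 + ε - (δ / 2) ^ 2 - dist c x ^ 2)) := by
      have h1 := ((hyv.const_mul (2 * r)).add (((tendsto_const_nhds (x := x)).dist hy).pow 2)).comp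
        hθt
      exact ((h1.add_const ε).sub_const _).sub_const _
    have hev : ∀ᶠ k in atTop, b * (2 * r) ≤ 2 * r * val (F (θ k)) (y (θ k)) +
        dist x (y (θ k)) ^ 2 + ε - (δ / 2) ^ 2 - dist c x ^ 2 := by
      filter_upwards [hθt.eventually (h.eventually_lt hweak hb), hθt.eventually hyd,
        eventually_add_dist_sq_le hc' x hε,
        hθt.eventually (Metric.tendsto_nhds.1 hy (δ / 2) (by positivity))] with k h1 h2 h3 h4
      rw [hwθ] at h1
      have hp : IsProx (F (θ k)) r x (u (θ k)) := (hF _).isProx_resolvent hr x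
      rw [← (hF _).coe_val hp.1] at h1
      have h1' : b < val (F (θ k)) (u (θ k)) := by exact_mod_cast h1
      have h5 := hp.add_dist_sq_le (hF _) hr h2
      have h6 : δ ≤ dist (u (θ k)) a := hφδ (ψ k)
      have h7 := dist_triangle (u (θ k)) (y (θ k)) a
      have h8 : δ / 2 ≤ dist (u (θ k)) (y (θ k)) := by linarith
      have h9 : (δ / 2) ^ 2 ≤ dist (u (θ k)) (y (θ k)) ^ 2 := by gcongr
      have h10 := mul_le_mul_of_nonneg_left h1'.le (by positivity : 0 ≤ 2 * r)
      have h11 := sq_nonneg (dist c (u (θ k)))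
      linarith
    have := ge_of_tendsto hlim hev
    linarith
  obtain ⟨hcd, hcv⟩ := hf.val_le key
  rw [le_div_iff₀ (by positivity)] at hcv
  have h1 := ha.2 c hcd
  have h2 : 0 < (δ / 2) ^ 2 := by positivity
  rw [dist_comm c x] at hcv
  linarith

end mosco

end Hadamard

/-- The first two conjuncts say that the resolvents and the semigroups are well defined (unique
minimizers and existing limits); the last two are the convergence assertions. -/
theorem theorem4p3 {X : Type*} [MetricSpace X] [Hadamard.HadamardSpace X]
    (f : X → EReal) (F : ℕ → X → EReal)
    (hf : Hadamard.IsProperConvexLsc f) (hF : ∀ n, Hadamard.IsProperConvexLsc (F n)) :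
    (∀ r : ℝ, 0 < r → ∀ x y : X,
      (IsMinOn (Hadamard.proxFun f r x) Set.univ y ↔ y = Hadamard.resolvent f r x) ∧
      ∀ n, (IsMinOn (Hadamard.proxFun (F n) r x) Set.univ y ↔
        y = Hadamard.resolvent (F n) r x)) ∧
    (∀ x ∈ closure (Hadamard.dom f), ∀ t : ℝ, 0 < t →
      Tendsto (fun k : ℕ => (Hadamard.resolvent f (t / k))^[k] x) atTop
        (𝓝 (Hadamard.semigroup f t x)) ∧
      ∀ n, Tendsto (fun k : ℕ => (Hadamard.resolvent (F n) (t / k))^[k] x) atTop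
        (𝓝 (Hadamard.semigroup (F n) t x))) ∧
    ((∀ x ∈ closure (Hadamard.dom f), ∀ r : ℝ, 0 < r →
        Tendsto (fun n => Hadamard.resolvent (F n) r x) atTop
          (𝓝 (Hadamard.resolvent f r x))) →
      ∀ x ∈ closure (Hadamard.dom f), ∀ t : ℝ, 0 < t →
        Tendsto (fun n => Hadamard.semigroup (F n) t x) atTop
          (𝓝 (Hadamard.semigroup f t x))) ∧
    (Hadamard.MoscoTendsto F f →
      ∀ x ∈ closure (Hadamard.dom f), ∀ t : ℝ, 0 < t →
        Tendsto (fun n => Hadamard.semigroup (F n) t x) atTop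
          (𝓝 (Hadamard.semigroup f t x))) := by
  refine ⟨fun r hr x y => ⟨hf.isMinOn_iff_eq_resolvent hr x y,
      fun n => (hF n).isMinOn_iff_eq_resolvent hr x y⟩,
    fun x _ t ht => ⟨hf.tendsto_semigroup ht x, fun n => (hF n).tendsto_semigroup ht x⟩,
    fun h x hx t ht => Hadamard.tendsto_semigroup_of_tendsto_resolvent hf hF h hx ht,
    fun h x hx t ht => ?_⟩
  exact Hadamard.tendsto_semigroup_of_tendsto_resolvent hf hF
    (fun x _ r hr => h.tendsto_resolvent hf hF hr x) hx ht
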